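/- Let $\mathbb S^m$ be the unit sphere of $\mathbb R^{m+1}$, let $d(n,x)=\arccos\langle n,x\rangle$ be its standard distance, and let $\sigma$ be the uniform Borel probability measure on $\mathbb S^m$. Let the cost $c:\mathbb S^m\times\mathbb S^m\to[0,+\infty]$ be defined by $c(n,x)=-\log\cos d(n,x)=-\log\langle n,x\rangle$ if $d(n,x)<\pi/2$, and $c(n,x)=+\infty$ otherwise. A set $\omega\subset\mathbb S^m$ is called convex if the cone $\{t x : t\ge 0,\ x\in\omega\}$ is convex in $\mathbb R^{m+1}$. Let $\mu$ be a Borel probability measure on $\mathbb S^m$ satisfying Alexandrov's condition: for every nonempty convex (Borel) set $\omega\subsetneq\mathbb S^m$, $$\mu(\omega)<\sigma(\omega_{\pi/2}),\qquad \omega_{\pi/2}=\{x\in\mathbb S^m : d(x,\omega)<\pi/2\}.$$ Let $\Gamma(\sigma,\mu)$ be the set of transport plans, that is, of Borel probability measures $\Pi$ on $\mathbb S^m\times\mathbb S^m$ with first marginal $\sigma$ and second marginal $\mu$, and let $\Gamma_0(\sigma,\mu)$ be the set of optimal plans, that is, of those $\Pi\in\Gamma(\sigma,\mu)$ which minimize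 $\int c\,d\Pi$ over $\Gamma(\sigma,\mu)$. Set $$\Gamma:=\overline{\bigcup_{\Pi_0\in\Gamma_0(\sigma,\mu)}\operatorname{Supp}(\Pi_0)}\ \cap\ \{c<+\infty\}.$$ For $\phi:\mathbb S^m\to\mathbb R\cup\{-\infty\}$ the $c$-transform is $\phi^c(x)=\inf_{n\in\mathbb S^m}\bigl(c(n,x)-\phi(n)\bigr)$; the function $\phi$ is $c$-concave if $\phi^c(x)<+\infty$ for all $x\in\mathbb S^m$ and $(\phi^c)^c=\phi$; its $c$-subdifferential is $\partial_c\phi=\{(n,x)\in\mathbb S^m\times\mathbb S^m : \phi(n)+\phi^c(x)=c(n,x)\}$. **Theorem.** There exists a real-valued function $\phi$ on $\mathbb S^m$ which is Lipschitz (with respect to $d$) and $c$-concave, such that $\Gamma\subset\partial_c\phi$. -/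

import Mathlib

open MeasureTheory Set
open scoped ENNReal NNReal

noncomputable section

namespace GaussOT

/-- The unit sphere `S^m` of `ℝ^(m+1)`, with its subspace topology and Borel `σ`-algebra. -/
abbrev Sph (m : ℕ) : Type := Metric.sphere (0 : EuclideanSpace ℝ (Fin (m + 1))) 1

variable {m : ℕ}

/-- The standard (angular) distance `d` on the sphere, with values in `[0, π]`. -/
def sphereDist (x y : Sph m) : ℝ :=
  InnerProductGeometry.angle (x : EuclideanSpace ℝ (Fin (m + 1))) (y : EuclideanSpace ℝ (Fin (m + 1)))

/-- The uniform Borel probability measure `σ` on the sphere: normalized surface measure. -/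
def uniformMeasure (m : ℕ) : Measure (Sph m) :=
  ((volume : Measure (EuclideanSpace ℝ (Fin (m + 1)))).toSphere univ)⁻¹ •
    (volume : Measure (EuclideanSpace ℝ (Fin (m + 1)))).toSphere

/-- A subset of the sphere is convex if the Euclidean cone `{t x : t ≥ 0, x ∈ ω}` which it
generates is convex. -/
def SphConvex (ω : Set (Sph m)) : Prop :=
  Convex ℝ {v : EuclideanSpace ℝ (Fin (m + 1)) |
    ∃ t : ℝ, 0 ≤ t ∧ ∃ x ∈ ω, v = t • (x : EuclideanSpace ℝ (Fin (m + 1)))}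

/-- The open neighbourhood `ω_{π/2} = {x : d(x, ω) < π/2}`; the distance to `ω` (an infimum) is
`< π/2` exactly when some point of `ω` is at distance `< π/2`. -/
def halfPiNhd (ω : Set (Sph m)) : Set (Sph m) :=
  {x | ∃ y ∈ ω, sphereDist x y < Real.pi / 2}

/-- Alexandrov's condition: `μ(ω) < σ(ω_{π/2})` for every nonempty (Borel) convex `ω ⊊ S^m`. -/
def AlexandrovCondition (μ : Measure (Sph m)) : Prop :=
  ∀ ω : Set (Sph m), MeasurableSet ω → ω.Nonempty → ω ≠ univ → SphConvex ω →
    μ ω < uniformMeasure m (halfPiNhd ω)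

open Classical in
/-- The cost `c(n, x) = -log cos d(n, x)` if `d(n, x) < π/2`, and `+∞` otherwise. The real number
`-log cos d(n, x)` is nonnegative there, so `ENNReal.ofReal` does not truncate it. -/
def cost (n x : Sph m) : ℝ≥0∞ :=
  if sphereDist n x < Real.pi / 2 then ENNReal.ofReal (-Real.log (Real.cos (sphereDist n x))) else ⊤

theorem cost_comm (n x : Sph m) : cost n x = cost x n := by
  have h : sphereDist n x = sphereDist x n := InnerProductGeometry.angle_comm _ _
  unfold cost
  rw [h]

/-- The transport plans: probability measures on the product with marginals `σ` (in the variable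
`n`) and `μ` (in the variable `x`). -/
def transportPlans (σ μ : Measure (Sph m)) : Set (Measure (Sph m × Sph m)) :=
  {P | IsProbabilityMeasure P ∧ P.fst = σ ∧ P.snd = μ}

/-- The total cost `∫ c dP`, in `[0, ∞]`. -/
def transportCost (P : Measure (Sph m × Sph m)) : ℝ≥0∞ := ∫⁻ p, cost p.1 p.2 ∂P

/-- The optimal plans: the minimizers of the total cost among the transport plans. -/
def optimalPlans (σ μ : Measure (Sph m)) : Set (Measure (Sph m × Sph m)) :=
  {P | P ∈ transportPlans σ μ ∧ ∀ Q ∈ transportPlans σ μ, transportCost P ≤ transportCost Q}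

/-- The set `Γ`: the closure of the union of the supports of all optimal plans from `σ` to `μ`,
intersected with `{c < ∞}`. -/
def optimalSupport (μ : Measure (Sph m)) : Set (Sph m × Sph m) :=
  closure (⋃ P ∈ optimalPlans (uniformMeasure m) μ, P.support) ∩ {p | cost p.1 p.2 < ⊤}

/-- The `c`-transform `φ^c(x) = inf_n (c(n, x) - φ(n))` of a function with values in
`ℝ ∪ {-∞, +∞}`. It is used for functions that do not take the value `+∞`, so that the difference
is always meaningful. As `c` is symmetric, the same formula serves in both variables. -/
def cTransform (φ : Sph m → EReal) (x : Sph m) : EReal :=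
  ⨅ n : Sph m, ((cost n x : ℝ≥0∞) : EReal) - φ n

/-- A function `φ : S^m → ℝ ∪ {-∞}` is `c`-concave if `φ^c < +∞` everywhere and `(φ^c)^c = φ`. -/
def CConcave (φ : Sph m → EReal) : Prop :=
  (∀ n, φ n < ⊤) ∧ (∀ x, cTransform φ x < ⊤) ∧ cTransform (cTransform φ) = φ

/-- The `c`-subdifferential `∂_c φ = {(n, x) : φ(n) + φ^c(x) = c(n, x)}`. -/
def cSubdifferential (φ : Sph m → EReal) : Set (Sph m × Sph m) :=
  {p | φ p.1 + cTransform φ p.2 = ((cost p.1 p.2 : ℝ≥0∞) : EReal)}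

end GaussOT

end

/-!
The potentials come from the dual Kantorovich problem for a truncated cost, whose optimal pair turns
out not to see the truncation.

For `M ≥ 0` the function `k = min c M` is Lipschitz on the compact product of the sphere with
itself, so the dual problem of maximizing `∫ φ dσ + ∫ ψ dμ` under `φ ⊕ ψ ≤ k` has a solution
which is a pair of Lipschitz `k`-conjugate functions (`exists_optimal_conjugatePair`, by the Arzelà–Ascoli
theorem), normalized by `max ψ = 0`. The Hahn–Banach and Riesz–Markov–Kakutani theorems provide a
transport plan concentrated on the contact set `{φ ⊕ ψ = k}` (`exists_plan_of_optimal`).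

Alexandrov's condition enters through a bound on `φ` that does not depend on `M`
(`IsConjugatePair.fst_le_of_uniformlySpread`). Compactness of the space of closed sets for the
Hausdorff distance upgrades the condition to a uniform one: there is `ε > 0` such that, for every
nonempty closed `ω`, either each point `n` satisfies `⟪n, x⟫ ≥ ε` for some `x ∈ ω`, or
`μ ω + ε ≤ σ {n | ∃ x ∈ ω, ⟪n, x⟫ ≥ ε}` (`AlexandrovCondition.exists_uniformlySpread`). Applied
to the sublevel sets of `-ψ` and integrated over the levels, this yields
`∫ φ dσ + ∫ ψ dμ ≤ L - ε (max φ - L)` with `L = log (1/ε)`. The left-hand side is nonnegative for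
an optimal pair, as `(0, 0)` is admissible; hence `max φ ≤ L + L/ε`.

If `M` exceeds this bound, then `φ ⊕ ψ < M` and `k = c` on the contact set, so `φ` and `ψ` are
`c`-conjugate, and the plan above has finite `c`-cost `∫ φ dσ + ∫ ψ dμ`. Since `φ ⊕ ψ ≤ c`, every
optimal plan is then concentrated on the contact set (`support_subset_contact`), which is closed.
-/

set_option linter.unusedSectionVars false

noncomputable section

namespace GaussOT

/-! ### Kantorovich duality for a continuous cost -/

section Duality

variable {X : Type*} [MetricSpace X] [CompactSpace X] [SecondCountableTopology X]
  [MeasurableSpace X] [BorelSpace X]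

theorem integrable_continuousMap {Z : Type*} [TopologicalSpace Z] [CompactSpace Z]
    [MeasurableSpace Z] [OpensMeasurableSpace Z] (ν : Measure Z) [IsFiniteMeasure ν]
    (f : C(Z, ℝ)) : Integrable f ν :=
  f.continuous.integrable_of_hasCompactSupport (HasCompactSupport.of_compactSpace _)

/-- The Riesz–Markov–Kakutani theorem on a compact space, for linear forms on `C(Z, ℝ)`. -/
theorem exists_measure_of_nonneg {Z : Type*} [TopologicalSpace Z] [T2Space Z] [CompactSpace Z]
    [MeasurableSpace Z] [BorelSpace Z] (L : C(Z, ℝ) →ₗ[ℝ] ℝ)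
    (hL : ∀ f : C(Z, ℝ), 0 ≤ f → 0 ≤ L f) :
    ∃ P : Measure Z, IsFiniteMeasure P ∧ ∀ f : C(Z, ℝ), ∫ z, f z ∂P = L f := by
  open CompactlySupported in
  let Λ : C_c(Z, ℝ) →ₚ[ℝ] ℝ := PositiveLinearMap.mk₀
    { toFun := fun f => L f.toContinuousMap
      map_add' := fun f g => by rw [← map_add]; rfl
      map_smul' := fun a f => by rw [RingHom.id_apply, ← map_smul]; rfl }
    (fun f hf => hL _ hf)
  refine ⟨RealRMK.rieszMeasure Λ, inferInstance, fun f => ?_⟩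
  exact RealRMK.integral_rieszMeasure Λ (CompactlySupportedContinuousMap.continuousMapEquiv f)

/-- The function `(x, y) ↦ f x + h y`. -/
def directSum (f h : C(X, ℝ)) : C(X × X, ℝ) :=
  f.comp ContinuousMap.fst + h.comp ContinuousMap.snd

@[simp] theorem directSum_apply (f h : C(X, ℝ)) (p : X × X) :
    directSum f h p = f p.1 + h p.2 := rfl

variable (σ μ : Measure X)

/-- The values `∫ f dσ + ∫ h dμ` over the pairs with `g ≤ f ⊕ h + t w` for some `t ≥ 0`. Their
infimum is a sublinear function of `g`; the term `t w` makes it nonpositive at `w`, so that a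
linear form below it is represented by a plan which does not charge `{w > 0}`. -/
def majorantValues (w g : C(X × X, ℝ)) : Set ℝ :=
  {r | ∃ (f h : C(X, ℝ)) (t : ℝ), 0 ≤ t ∧ (∀ p, g p ≤ f p.1 + h p.2 + t * w p) ∧
    r = ∫ x, f x ∂σ + ∫ y, h y ∂μ}

variable {σ μ} [IsProbabilityMeasure σ] [IsProbabilityMeasure μ]

theorem majorantValues_nonempty (w g : C(X × X, ℝ)) : (majorantValues σ μ w g).Nonempty :=
  ⟨_, ContinuousMap.const X ‖g‖, 0, 0, le_rfl,
    fun p => by simpa using (le_abs_self _).trans (g.norm_coe_le_norm p), rfl⟩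

/-- Since `(0, 0)` is optimal for the cost `w`, hence for all its multiples `t w`, the infimum of
`majorantValues` is finite. -/
theorem neg_norm_le_of_mem_majorantValues {w : C(X × X, ℝ)} (hw : 0 ≤ w)
    (hopt : ∀ f h : C(X, ℝ), (∀ p : X × X, f p.1 + h p.2 ≤ w p) →
      ∫ x, f x ∂σ + ∫ y, h y ∂μ ≤ 0)
    {g : C(X × X, ℝ)} {r : ℝ} (hr : r ∈ majorantValues σ μ w g) : -‖g‖ ≤ r := by
  obtain ⟨f, h, t, ht, hle, rfl⟩ := hr
  have ht1 : 0 < t + 1 := by linarith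
  have key := hopt ((t + 1)⁻¹ • (-f - ContinuousMap.const X ‖g‖)) ((t + 1)⁻¹ • (-h)) (fun p => by
    have h1 := hle p
    have h2 := (neg_le_abs _).trans (g.norm_coe_le_norm p)
    have h3 : 0 ≤ w p := hw p
    simp only [ContinuousMap.coe_smul, ContinuousMap.coe_sub, ContinuousMap.coe_neg,
      Pi.smul_apply, Pi.sub_apply, Pi.neg_apply, ContinuousMap.const_apply, smul_eq_mul]
    rw [← mul_add, inv_mul_le_iff₀ ht1]
    linarith)
  simp only [ContinuousMap.coe_smul, ContinuousMap.coe_sub, ContinuousMap.coe_neg,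
      Pi.smul_apply, Pi.sub_apply, Pi.neg_apply, ContinuousMap.const_apply, smul_eq_mul,
      integral_const_mul] at key
  rw [← mul_add, inv_mul_le_iff₀ ht1, integral_sub (f := fun a => -f a)
    (integrable_continuousMap σ f).neg (integrable_const _), integral_neg, integral_neg] at key
  simp at key
  linarith

/-- Complementary slackness: an optimal pair `(φ, ψ)` of potentials for the continuous cost `k`
admits a transport plan concentrated on the contact set `{φ ⊕ ψ = k}`. -/
theorem exists_plan_of_optimal (k : C(X × X, ℝ)) (φ ψ : C(X, ℝ))
    (hle : ∀ p : X × X, φ p.1 + ψ p.2 ≤ k p)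
    (hopt : ∀ f h : C(X, ℝ), (∀ p : X × X, f p.1 + h p.2 ≤ k p) →
      ∫ x, f x ∂σ + ∫ y, h y ∂μ ≤ ∫ x, φ x ∂σ + ∫ y, ψ y ∂μ) :
    ∃ P : Measure (X × X), IsProbabilityMeasure P ∧ P.fst = σ ∧ P.snd = μ ∧
      ∀ᵐ p ∂P, φ p.1 + ψ p.2 = k p := by
  -- For the slack `w = k - φ ⊕ ψ ≥ 0`, the optimal pair is `(0, 0)`.
  set w : C(X × X, ℝ) := k - directSum φ ψ with hwdef
  have hw : 0 ≤ w := fun p => by simpa [hwdef] using hle p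
  have hopt' : ∀ f h : C(X, ℝ), (∀ p : X × X, f p.1 + h p.2 ≤ w p) →
      ∫ x, f x ∂σ + ∫ y, h y ∂μ ≤ 0 := by
    intro f h hfh
    have := hopt (f + φ) (h + ψ) (fun p => by
      have := hfh p
      simp only [hwdef, ContinuousMap.coe_sub, Pi.sub_apply, directSum_apply] at this
      simp only [ContinuousMap.coe_add, Pi.add_apply]
      linarith)
    simp only [ContinuousMap.coe_add, Pi.add_apply] at this
    rw [integral_add (integrable_continuousMap σ f) (integrable_continuousMap σ φ),
      integral_add (integrable_continuousMap μ h) (integrable_continuousMap μ ψ)] at this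
    linarith
  have hbdd : ∀ g, BddBelow (majorantValues σ μ w g) := fun g =>
    ⟨-‖g‖, fun r hr => neg_norm_le_of_mem_majorantValues hw hopt' hr⟩
  have hne := majorantValues_nonempty (σ := σ) (μ := μ) w
  let N : C(X × X, ℝ) → ℝ := fun g => sInf (majorantValues σ μ w g)
  have hNle : ∀ (g : C(X × X, ℝ)) (f h : C(X, ℝ)) (t : ℝ), 0 ≤ t →
      (∀ p, g p ≤ f p.1 + h p.2 + t * w p) → N g ≤ ∫ x, f x ∂σ + ∫ y, h y ∂μ :=
    fun g f h t ht hg => csInf_le (hbdd g) ⟨f, h, t, ht, hg, rfl⟩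
  have hN_add : ∀ g₁ g₂, N (g₁ + g₂) ≤ N g₁ + N g₂ := by
    intro g₁ g₂
    rw [← sub_le_iff_le_add]
    refine le_csInf (hne g₁) ?_
    rintro _ ⟨f₁, h₁, t₁, ht₁, hg₁, rfl⟩
    rw [sub_le_iff_le_add, ← sub_le_iff_le_add']
    refine le_csInf (hne g₂) ?_
    rintro _ ⟨f₂, h₂, t₂, ht₂, hg₂, rfl⟩
    have := hNle (g₁ + g₂) (f₁ + f₂) (h₁ + h₂) (t₁ + t₂) (by positivity) (fun p => by
      simp only [ContinuousMap.coe_add, Pi.add_apply]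
      linarith [hg₁ p, hg₂ p])
    simp only [ContinuousMap.coe_add, Pi.add_apply] at this
    rw [integral_add (integrable_continuousMap σ f₁) (integrable_continuousMap σ f₂),
      integral_add (integrable_continuousMap μ h₁) (integrable_continuousMap μ h₂)] at this
    linarith
  have hN_smul_le : ∀ c : ℝ, 0 < c → ∀ g, N (c • g) ≤ c * N g := by
    intro c hc g
    rw [← div_le_iff₀' hc]
    refine le_csInf (hne g) ?_
    rintro _ ⟨f, h, t, ht, hg, rfl⟩
    rw [div_le_iff₀' hc]
    have := hNle (c • g) (c • f) (c • h) (c * t) (by positivity) (fun p => by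
      have := mul_le_mul_of_nonneg_left (hg p) hc.le
      simp only [ContinuousMap.coe_smul, Pi.smul_apply, smul_eq_mul]
      linarith)
    simp only [ContinuousMap.coe_smul, Pi.smul_apply, smul_eq_mul, integral_const_mul] at this
    linarith
  have hN_smul : ∀ c : ℝ, 0 < c → ∀ g, N (c • g) = c * N g := by
    intro c hc g
    refine le_antisymm (hN_smul_le c hc g) ?_
    have := hN_smul_le c⁻¹ (inv_pos.2 hc) (c • g)
    rwa [smul_smul, inv_mul_cancel₀ hc.ne', one_smul, le_inv_mul_iff₀ hc] at this
  -- Hahn–Banach, from the zero subspace: any linear form below `N` will do.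
  obtain ⟨L, -, hL⟩ := exists_extension_of_le_sublinear (⊥ : C(X × X, ℝ) →ₗ.[ℝ] ℝ) N hN_smul hN_add
    (by
      rintro ⟨x, hx⟩
      have hx0 : x = 0 := (Submodule.mem_bot ℝ).1 hx
      subst hx0
      have h0 : N 0 = 0 := by
        have := hN_smul 2 two_pos 0
        rw [smul_zero] at this
        linarith
      have hz : (⟨0, hx⟩ : (⊥ : C(X × X, ℝ) →ₗ.[ℝ] ℝ).domain) = 0 := rfl
      rw [hz, LinearPMap.map_zero]
      exact h0.ge)
  have hLle : ∀ (g : C(X × X, ℝ)) (f h : C(X, ℝ)) (t : ℝ), 0 ≤ t →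
      (∀ p, g p ≤ f p.1 + h p.2 + t * w p) → L g ≤ ∫ x, f x ∂σ + ∫ y, h y ∂μ :=
    fun g f h t ht hg => (hL g).trans (hNle g f h t ht hg)
  have hLpos : ∀ g, 0 ≤ g → 0 ≤ L g := by
    intro g hg
    have := hLle (-g) 0 0 0 le_rfl (fun p => by simpa using hg p)
    simpa using this
  have hLds : ∀ f h : C(X, ℝ), L (directSum f h) = ∫ x, f x ∂σ + ∫ y, h y ∂μ := by
    intro f h
    refine le_antisymm (hLle _ f h 0 le_rfl (fun p => by simp)) ?_
    have := hLle (-directSum f h) (-f) (-h) 0 le_rfl (fun p => by simp [add_comm])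
    simp only [map_neg, ContinuousMap.coe_neg, Pi.neg_apply, integral_neg] at this
    linarith
  have hLw : L w ≤ 0 := by
    simpa using hLle w 0 0 1 zero_le_one (fun p => by simp)
  obtain ⟨P, hPfin, hP⟩ := exists_measure_of_nonneg L hLpos
  have hfst : P.fst = σ := by
    refine ext_of_forall_integral_eq_of_IsFiniteMeasure fun f => ?_
    rw [Measure.fst, integral_map measurable_fst.aemeasurable
      f.continuous.aestronglyMeasurable]
    have := (hP (directSum f.toContinuousMap 0)).trans (hLds _ _)
    simpa using this
  have hsnd : P.snd = μ := by
    refine ext_of_forall_integral_eq_of_IsFiniteMeasure fun f => ?_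
    rw [Measure.snd, integral_map measurable_snd.aemeasurable
      f.continuous.aestronglyMeasurable]
    have := (hP (directSum 0 f.toContinuousMap)).trans (hLds _ _)
    simpa using this
  refine ⟨P, ⟨?_⟩, hfst, hsnd, ?_⟩
  · rw [← Measure.fst_univ, hfst, measure_univ]
  · have hz : ∫ p, w p ∂P = 0 :=
      le_antisymm ((hP w).trans_le hLw) (integral_nonneg hw)
    have := (integral_eq_zero_iff_of_nonneg hw (integrable_continuousMap P w)).1 hz
    filter_upwards [this] with p hp
    have hp' : k p - (φ p.1 + ψ p.2) = 0 := hp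
    linarith

end Duality

/-! ### Existence of optimal potentials for a Lipschitz cost -/

section Potentials

variable {X : Type*} [MetricSpace X] [CompactSpace X] [SecondCountableTopology X]
  [MeasurableSpace X] [BorelSpace X]

/-- `φ` and `ψ` are conjugate for the symmetric cost `k`: each is the `k`-transform of the other
(with the infimum attained). The additive constant is fixed by `max ψ = 0`. -/
structure IsConjugatePair (k : C(X × X, ℝ)) (φ ψ : C(X, ℝ)) : Prop where
  add_le : ∀ p : X × X, φ p.1 + ψ p.2 ≤ k p
  exists_fst : ∀ x, ∃ n, φ n + ψ x = k (n, x)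
  exists_snd : ∀ n, ∃ x, φ n + ψ x = k (n, x)
  nonpos : ∀ x, ψ x ≤ 0
  exists_zero : ∃ x, ψ x = 0

theorem IsConjugatePair.fst_nonneg {k : C(X × X, ℝ)} {φ ψ : C(X, ℝ)} (h : IsConjugatePair k φ ψ)
    (hk : 0 ≤ k) (n : X) : 0 ≤ φ n := by
  obtain ⟨x, hx⟩ := h.exists_snd n
  have h1 : 0 ≤ k (n, x) := hk _
  linarith [h.nonpos x]

theorem IsConjugatePair.fst_le {k : C(X × X, ℝ)} {φ ψ : C(X, ℝ)} (h : IsConjugatePair k φ ψ)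
    {C : ℝ} (hk : ∀ p, k p ≤ C) (n : X) : φ n ≤ C := by
  obtain ⟨x, hx⟩ := h.exists_zero
  linarith [h.add_le (n, x), hk (n, x)]

theorem IsConjugatePair.neg_le_snd {k : C(X × X, ℝ)} {φ ψ : C(X, ℝ)} (h : IsConjugatePair k φ ψ)
    (hk : 0 ≤ k) {C : ℝ} (hC : ∀ n, φ n ≤ C) (x : X) : -C ≤ ψ x := by
  obtain ⟨n, hn⟩ := h.exists_fst x
  have h1 : 0 ≤ k (n, x) := hk _
  linarith [hC n]

/-- The `k`-transform of a continuous function is Lipschitz, with the constant of `k`. -/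
theorem exists_kTransform [Nonempty X] {k : C(X × X, ℝ)} {K : ℝ≥0}
    (hK : ∀ n, LipschitzWith K (fun x => k (n, x))) (f : C(X, ℝ)) :
    ∃ g : C(X, ℝ), LipschitzWith K g ∧ (∀ p : X × X, f p.1 + g p.2 ≤ k p) ∧
      ∀ x, ∃ n, f n + g x = k (n, x) := by
  have hmin : ∀ x, ∃ n, ∀ n', k (n, x) - f n ≤ k (n', x) - f n' := by
    intro x
    have hc : Continuous fun n => k (n, x) - f n := by fun_prop
    obtain ⟨n, -, hn⟩ := isCompact_univ.exists_isMinOn univ_nonempty hc.continuousOn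
    exact ⟨n, fun n' => hn (mem_univ n')⟩
  choose N hN using hmin
  have hLip : LipschitzWith K (fun x => k (N x, x) - f (N x)) := by
    refine LipschitzWith.of_le_add_mul K fun x y => ?_
    have h1 := hN x (N y)
    have h2 := (abs_le.1 ((Real.dist_eq _ _).symm.trans_le ((hK (N y)).dist_le_mul x y))).2
    linarith
  exact ⟨⟨_, hLip.continuous⟩, hLip, fun p => by simpa using by linarith [hN p.2 p.1],
    fun x => ⟨N x, by simp⟩⟩

variable {σ μ : Measure X} [IsProbabilityMeasure σ] [IsProbabilityMeasure μ]

/-- Taking the `k`-transform twice increases the value of an admissible pair; the constant shift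
that makes `max ψ = 0` does not change it, as `σ` and `μ` have the same mass. -/
theorem exists_conjugatePair_ge {k : C(X × X, ℝ)} (hsymm : ∀ x y, k (x, y) = k (y, x)) {K : ℝ≥0}
    (hK : ∀ n, LipschitzWith K (fun x => k (n, x))) {f h : C(X, ℝ)}
    (hfh : ∀ p : X × X, f p.1 + h p.2 ≤ k p) :
    ∃ φ ψ : C(X, ℝ), LipschitzWith K φ ∧ LipschitzWith K ψ ∧ IsConjugatePair k φ ψ ∧
      ∫ x, f x ∂σ + ∫ y, h y ∂μ ≤ ∫ x, φ x ∂σ + ∫ y, ψ y ∂μ := by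
  have : Nonempty X := nonempty_of_isProbabilityMeasure σ
  obtain ⟨ψ, hψL, hψ, hψc⟩ := exists_kTransform hK f
  obtain ⟨φ, hφL, hφ, hφc⟩ := exists_kTransform hK ψ
  have hψh : ∀ x, h x ≤ ψ x := by
    intro x
    obtain ⟨n, hn⟩ := hψc x
    have := hfh (n, x)
    linarith
  have hle : ∀ n x, φ n + ψ x ≤ k (n, x) := fun n x => by
    have := hφ (x, n)
    rw [hsymm] at this
    linarith
  have hφf : ∀ n, f n ≤ φ n := by
    intro n
    obtain ⟨x, hx⟩ := hφc n
    have := hψ (n, x)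
    rw [hsymm] at hx
    linarith
  obtain ⟨z, -, hz⟩ := isCompact_univ.exists_isMaxOn univ_nonempty ψ.continuous.continuousOn
  refine ⟨φ + ContinuousMap.const X (ψ z), ψ - ContinuousMap.const X (ψ z), ?_, ?_,
    ⟨?_, ?_, ?_, ?_, z, by simp⟩, ?_⟩
  · exact LipschitzWith.of_le_add_mul K fun x y => by
      have := (abs_le.1 ((Real.dist_eq _ _).symm.trans_le (hφL.dist_le_mul x y))).2
      simp only [ContinuousMap.add_apply, ContinuousMap.const_apply]
      linarith
  · exact LipschitzWith.of_le_add_mul K fun x y => by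
      have := (abs_le.1 ((Real.dist_eq _ _).symm.trans_le (hψL.dist_le_mul x y))).2
      simp only [ContinuousMap.sub_apply, ContinuousMap.const_apply]
      linarith
  · intro p
    have := hle p.1 p.2
    simp only [ContinuousMap.add_apply, ContinuousMap.sub_apply, ContinuousMap.const_apply]
    linarith
  · intro x
    obtain ⟨n, hn⟩ := hψc x
    refine ⟨n, ?_⟩
    have h1 := hle n x
    have h2 := hφf n
    simp only [ContinuousMap.add_apply, ContinuousMap.sub_apply, ContinuousMap.const_apply]
    linarith
  · intro n
    obtain ⟨x, hx⟩ := hφc n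
    refine ⟨x, ?_⟩
    rw [hsymm] at hx
    simp only [ContinuousMap.add_apply, ContinuousMap.sub_apply, ContinuousMap.const_apply]
    linarith
  · intro x
    simpa using hz (mem_univ x)
  · simp only [ContinuousMap.add_apply, ContinuousMap.sub_apply, ContinuousMap.const_apply]
    rw [integral_add (integrable_continuousMap σ φ) (integrable_const _),
      integral_sub (integrable_continuousMap μ ψ) (integrable_const _)]
    have h1 := integral_mono (integrable_continuousMap σ f) (integrable_continuousMap σ φ) hφf
    have h2 := integral_mono (integrable_continuousMap μ h) (integrable_continuousMap μ ψ) hψh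
    simp only [integral_const, probReal_univ, smul_eq_mul, one_mul]
    linarith

/-- The Arzelà–Ascoli theorem for uniformly Lipschitz functions. -/
theorem isCompact_lipschitz_abs_le (K : ℝ≥0) (C : ℝ) :
    IsCompact {f : C(X, ℝ) | LipschitzWith K f ∧ ∀ x, |f x| ≤ C} := by
  refine ArzelaAscoli.isCompact_of_equicontinuous _ ?_ ?_
  · have himg : ContinuousMap.toFun '' {f : C(X, ℝ) | LipschitzWith K f ∧ ∀ x, |f x| ≤ C} =
        {f : X → ℝ | LipschitzWith K f} ∩ Set.pi univ fun _ => Icc (-C) C := by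
      ext f
      constructor
      · rintro ⟨f, ⟨h1, h2⟩, rfl⟩
        exact ⟨h1, fun x _ => abs_le.1 (h2 x)⟩
      · rintro ⟨h1, h2⟩
        exact ⟨⟨f, h1.continuous⟩, ⟨h1, fun x => abs_le.2 (h2 x (mem_univ x))⟩, rfl⟩
    rw [himg]
    refine (isCompact_univ_pi fun _ => isCompact_Icc).inter_left ?_
    simp only [lipschitzWith_iff_dist_le_mul, ofPred_forall]
    refine isClosed_iInter fun x => isClosed_iInter fun y => isClosed_le ?_ continuous_const
    exact (continuous_apply x).dist (continuous_apply y)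
  · refine (LipschitzWith.uniformEquicontinuous _ K fun f => f.2.1).equicontinuous

theorem continuous_integral_continuousMap (ν : Measure X) [IsFiniteMeasure ν] :
    Continuous fun f : C(X, ℝ) => ∫ x, f x ∂ν := by
  have h : LipschitzWith ⟨ν.real univ, measureReal_nonneg⟩ (fun f : C(X, ℝ) => ∫ x, f x ∂ν) := by
    refine LipschitzWith.of_dist_le_mul fun f g => ?_
    rw [dist_eq_norm, ← integral_sub (integrable_continuousMap ν f) (integrable_continuousMap ν g),
      dist_eq_norm]
    refine (norm_integral_le_of_norm_le_const (C := ‖f - g‖)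
      (Filter.Eventually.of_forall fun x => (f - g).norm_coe_le_norm x)).trans_eq (mul_comm _ _)
  exact h.continuous

/-- The dual Kantorovich problem with a symmetric, nonnegative, Lipschitz cost has a solution
which is a conjugate pair of Lipschitz functions. -/
theorem exists_optimal_conjugatePair {k : C(X × X, ℝ)} (hk : 0 ≤ k)
    (hsymm : ∀ x y, k (x, y) = k (y, x)) {K : ℝ≥0}
    (hK : ∀ n, LipschitzWith K (fun x => k (n, x))) :
    ∃ φ ψ : C(X, ℝ), LipschitzWith K φ ∧ IsConjugatePair k φ ψ ∧
      ∀ f h : C(X, ℝ), (∀ p : X × X, f p.1 + h p.2 ≤ k p) →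
        ∫ x, f x ∂σ + ∫ y, h y ∂μ ≤ ∫ x, φ x ∂σ + ∫ y, ψ y ∂μ := by
  have hkC : ∀ p, k p ≤ ‖k‖ := fun p => (le_abs_self _).trans (k.norm_coe_le_norm p)
  let B : Set C(X, ℝ) := {f | LipschitzWith K f ∧ ∀ x, |f x| ≤ ‖k‖}
  have hB : IsCompact B := isCompact_lipschitz_abs_le K ‖k‖
  let S : Set (C(X, ℝ) × C(X, ℝ)) := (B ×ˢ B) ∩ {q | ∀ p : X × X, q.1 p.1 + q.2 p.2 ≤ k p}
  have hS : IsCompact S := by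
    refine (hB.prod hB).inter_right ?_
    simp only [ofPred_forall]
    refine isClosed_iInter fun p => isClosed_le ?_ continuous_const
    exact ((continuous_eval_const p.1).comp continuous_fst).add
      ((continuous_eval_const p.2).comp continuous_snd)
  have hmem : ∀ φ ψ : C(X, ℝ), LipschitzWith K φ → LipschitzWith K ψ → IsConjugatePair k φ ψ →
      (φ, ψ) ∈ S := fun φ ψ h1 h2 h =>
    ⟨⟨⟨h1, fun x => abs_le.2 ⟨by linarith [h.fst_nonneg hk x, norm_nonneg k], h.fst_le hkC x⟩⟩,
      ⟨h2, fun x => abs_le.2 ⟨h.neg_le_snd hk (h.fst_le hkC) x,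
        (h.nonpos x).trans (norm_nonneg k)⟩⟩⟩, h.add_le⟩
  obtain ⟨φ₀, ψ₀, h1, h2, h3, -⟩ := exists_conjugatePair_ge (σ := σ) (μ := μ) hsymm hK
    (f := 0) (h := 0) (fun p => by simpa using hk p)
  have hJ : Continuous fun q : C(X, ℝ) × C(X, ℝ) => ∫ x, q.1 x ∂σ + ∫ y, q.2 y ∂μ :=
    ((continuous_integral_continuousMap σ).comp continuous_fst).add
      ((continuous_integral_continuousMap μ).comp continuous_snd)
  obtain ⟨⟨φ₁, ψ₁⟩, hq, hmax⟩ := hS.exists_isMaxOn ⟨_, hmem _ _ h1 h2 h3⟩ hJ.continuousOn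
  obtain ⟨φ, ψ, hφ, -, hc, hge⟩ := exists_conjugatePair_ge (σ := σ) (μ := μ) hsymm hK hq.2
  refine ⟨φ, ψ, hφ, hc, fun f h hfh => ?_⟩
  obtain ⟨φ', ψ', hφ', hψ', hc', hge'⟩ := exists_conjugatePair_ge (σ := σ) (μ := μ) hsymm hK hfh
  exact hge'.trans ((hmax (hmem _ _ hφ' hψ' hc')).trans hge)

end Potentials

/-! ### A uniform version of Alexandrov's condition -/

section Alexandrov

open Filter Topology TopologicalSpace

variable {m : ℕ}

theorem inner_le_one (x y : Sph m) :
    inner ℝ (x : EuclideanSpace ℝ (Fin (m + 1))) (y : EuclideanSpace ℝ (Fin (m + 1))) ≤ 1 := by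
  simpa using real_inner_le_norm (x : EuclideanSpace ℝ (Fin (m + 1))) y

theorem inner_self_eq_one (x : Sph m) :
    inner ℝ (x : EuclideanSpace ℝ (Fin (m + 1))) (x : EuclideanSpace ℝ (Fin (m + 1))) = 1 := by
  rw [real_inner_self_eq_norm_sq, norm_eq_of_mem_sphere]
  norm_num

theorem cos_sphereDist (x y : Sph m) : Real.cos (sphereDist x y) =
    inner ℝ (x : EuclideanSpace ℝ (Fin (m + 1))) (y : EuclideanSpace ℝ (Fin (m + 1))) := by
  rw [sphereDist, InnerProductGeometry.cos_angle]
  simp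

theorem sphereDist_lt_pi_div_two_iff {x y : Sph m} : sphereDist x y < Real.pi / 2 ↔
    0 < inner ℝ (x : EuclideanSpace ℝ (Fin (m + 1))) (y : EuclideanSpace ℝ (Fin (m + 1))) := by
  rw [← cos_sphereDist]
  have h0 : 0 ≤ sphereDist x y := InnerProductGeometry.angle_nonneg _ _
  have hpi : sphereDist x y ≤ Real.pi := InnerProductGeometry.angle_le_pi _ _
  constructor
  · intro h
    exact Real.cos_pos_of_mem_Ioo ⟨by linarith [Real.pi_pos], h⟩
  · intro h
    by_contra! h'
    exact absurd (Real.cos_nonpos_of_pi_div_two_le_of_le h' (by linarith [Real.pi_pos])) h.not_ge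

theorem abs_inner_sub_inner_le (n x y : Sph m) :
    |inner ℝ (n : EuclideanSpace ℝ (Fin (m + 1))) (x : EuclideanSpace ℝ (Fin (m + 1))) -
      inner ℝ (n : EuclideanSpace ℝ (Fin (m + 1))) (y : EuclideanSpace ℝ (Fin (m + 1)))| ≤
      dist x y := by
  rw [← inner_sub_right, Subtype.dist_eq, dist_eq_norm]
  simpa using abs_real_inner_le_norm (n : EuclideanSpace ℝ (Fin (m + 1)))
    ((x : EuclideanSpace ℝ (Fin (m + 1))) - y)

/-- The points `n` of the sphere such that `⟪n, x⟫ ≥ ε` for some `x ∈ ω`: the points whose distance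
to `ω` is at most `π/2 - arcsin ε`, when `ω` is compact. -/
def innerNhd (ε : ℝ) (ω : Set (Sph m)) : Set (Sph m) :=
  {n | ∃ x ∈ ω,
    ε ≤ inner ℝ (n : EuclideanSpace ℝ (Fin (m + 1))) (x : EuclideanSpace ℝ (Fin (m + 1)))}

theorem innerNhd_anti {ε ε' : ℝ} (h : ε ≤ ε') (ω : Set (Sph m)) :
    innerNhd ε' ω ⊆ innerNhd ε ω :=
  fun _ ⟨x, hx, hn⟩ => ⟨x, hx, h.trans hn⟩

/-- The bipolar of `ω` is convex and has the same neighbourhood of radius `π/2` as `ω`, which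
extends Alexandrov's condition to arbitrary nonempty sets contained in a closed half-sphere. -/
theorem AlexandrovCondition.measure_lt {μ : Measure (Sph m)} (hμ : AlexandrovCondition μ)
    {ω : Set (Sph m)} (hne : ω.Nonempty) {n₀ : Sph m}
    (hn₀ : ∀ x ∈ ω, inner ℝ (n₀ : EuclideanSpace ℝ (Fin (m + 1)))
      (x : EuclideanSpace ℝ (Fin (m + 1))) ≤ 0) :
    μ ω < uniformMeasure m {n | ∃ x ∈ ω, 0 < inner ℝ (n : EuclideanSpace ℝ (Fin (m + 1)))
      (x : EuclideanSpace ℝ (Fin (m + 1)))} := by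
  let C : Set (EuclideanSpace ℝ (Fin (m + 1))) :=
    {v | ∀ n : EuclideanSpace ℝ (Fin (m + 1)),
      (∀ x ∈ ω, inner ℝ n (x : EuclideanSpace ℝ (Fin (m + 1))) ≤ 0) → inner ℝ n v ≤ 0}
  have hCconv : Convex ℝ C := by
    intro u hu v hv a b ha hb _ n hn
    rw [inner_add_right, inner_smul_right, inner_smul_right]
    have h1 := mul_nonpos_of_nonneg_of_nonpos ha (hu n hn)
    have h2 := mul_nonpos_of_nonneg_of_nonpos hb (hv n hn)
    linarith
  have hCclosed : IsClosed C := by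
    simp only [C, ofPred_forall]
    exact isClosed_iInter fun n => isClosed_iInter fun _ =>
      isClosed_le (by fun_prop) continuous_const
  let W : Set (Sph m) := {x | (x : EuclideanSpace ℝ (Fin (m + 1))) ∈ C}
  have hωW : ω ⊆ W := fun x hx n hn => hn x hx
  have hcone : {v : EuclideanSpace ℝ (Fin (m + 1)) |
      ∃ t : ℝ, 0 ≤ t ∧ ∃ x ∈ W, v = t • (x : EuclideanSpace ℝ (Fin (m + 1)))} = C := by
    ext v
    constructor
    · rintro ⟨t, ht, x, hx, rfl⟩ n hn
      rw [inner_smul_right]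
      exact mul_nonpos_of_nonneg_of_nonpos ht (hx n hn)
    · intro hv
      by_cases hv0 : v = 0
      · obtain ⟨x, hx⟩ := hne
        exact ⟨0, le_rfl, x, hωW hx, by simp [hv0]⟩
      · have hpos : 0 < ‖v‖ := norm_pos_iff.2 hv0
        refine ⟨‖v‖, hpos.le, ⟨‖v‖⁻¹ • v, ?_⟩, ?_, ?_⟩
        · rw [mem_sphere_zero_iff_norm, norm_smul, norm_inv, norm_norm, inv_mul_cancel₀ hpos.ne']
        · intro n hn
          change inner ℝ n (‖v‖⁻¹ • v) ≤ 0
          rw [inner_smul_right]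
          exact mul_nonpos_of_nonneg_of_nonpos (inv_nonneg.2 hpos.le) (hv n hn)
        · rw [smul_smul, mul_inv_cancel₀ hpos.ne', one_smul]
  have hWmeas : MeasurableSet W := (hCclosed.preimage continuous_subtype_val).measurableSet
  have hWuniv : W ≠ univ := by
    intro h
    have h1 : n₀ ∈ W := h ▸ mem_univ n₀
    have h2 := h1 n₀ hn₀
    rw [inner_self_eq_one] at h2
    linarith
  refine (measure_mono hωW).trans_lt ((hμ W hWmeas (hne.mono hωW) hWuniv
    (by rw [SphConvex, hcone]; exact hCconv)).trans_le (measure_mono ?_))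
  rintro n ⟨y, hy, hny⟩
  rw [sphereDist_lt_pi_div_two_iff] at hny
  by_contra! hcon
  simp only [mem_ofPred_eq, not_exists, not_and, not_lt] at hcon
  exact absurd (hy n hcon) hny.not_ge

/-- Quantitative Alexandrov condition for the set `ω`, with the margin `ε`. The first alternative
covers the sets `ω` which lie in no closed half-sphere, for which `μ ω < σ univ` may fail. -/
def UniformlySpread (σ μ : Measure (Sph m)) (ε : ℝ) (ω : Set (Sph m)) : Prop :=
  innerNhd ε ω = univ ∨ μ ω + ENNReal.ofReal ε ≤ σ (innerNhd ε ω)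

theorem UniformlySpread.anti {σ μ : Measure (Sph m)} {ε ε' : ℝ} {ω : Set (Sph m)}
    (h : UniformlySpread σ μ ε ω) (hε : ε' ≤ ε) : UniformlySpread σ μ ε' ω := by
  rcases h with h | h
  · exact Or.inl (univ_subset_iff.1 (h ▸ innerNhd_anti hε ω))
  · right
    calc μ ω + ENNReal.ofReal ε' ≤ μ ω + ENNReal.ofReal ε := by gcongr
      _ ≤ _ := h
      _ ≤ _ := measure_mono (innerNhd_anti hε ω)

/-- Both alternatives of `UniformlySpread` are stable under small Hausdorff perturbations. -/
theorem AlexandrovCondition.exists_uniformlySpread_near {μ : Measure (Sph m)}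
    [IsFiniteMeasure μ] (hμ : AlexandrovCondition μ) {ω : Set (Sph m)} (hc : IsClosed ω)
    (hne : ω.Nonempty) :
    ∃ ε > 0, ∀ ω' : Set (Sph m), (∀ x ∈ ω, ∃ y ∈ ω', dist x y < ε) →
      (∀ y ∈ ω', ∃ x ∈ ω, dist y x < ε) → UniformlySpread (uniformMeasure m) μ ε ω' := by
  let e : ℕ → ℝ := fun j => 1 / ((j : ℝ) + 1)
  have he : ∀ j, 0 < e j := fun j => Nat.one_div_pos_of_nat
  have he0 : Tendsto e atTop (𝓝 0) := tendsto_one_div_add_atTop_nhds_zero_nat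
  have heanti : Antitone e := fun i j hij => Nat.one_div_le_one_div hij
  let U : ℕ → Set (Sph m) := fun j => ⋃ x ∈ ω, {n : Sph m |
    2 * e j < inner ℝ (n : EuclideanSpace ℝ (Fin (m + 1))) (x : EuclideanSpace ℝ (Fin (m + 1)))}
  have hUmono : Monotone U := by
    intro i j hij n hn
    simp only [U, mem_iUnion, mem_ofPred_eq, exists_prop] at hn ⊢
    obtain ⟨x, hx, hn⟩ := hn
    exact ⟨x, hx, by linarith [heanti hij]⟩
  have hUopen : ∀ j, IsOpen (U j) := fun j => isOpen_biUnion fun x _ =>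
    isOpen_lt continuous_const (by fun_prop)
  have hUunion : {n : Sph m | ∃ x ∈ ω, 0 < inner ℝ (n : EuclideanSpace ℝ (Fin (m + 1)))
      (x : EuclideanSpace ℝ (Fin (m + 1)))} ⊆ ⋃ j, U j := by
    rintro n ⟨x, hx, hn⟩
    have h2 : Tendsto (fun j => 2 * e j) atTop (𝓝 0) := by simpa using he0.const_mul 2
    obtain ⟨j, hj⟩ := (h2.eventually_lt_const hn).exists
    simp only [U, mem_iUnion, mem_ofPred_eq, exists_prop]
    exact ⟨j, x, hx, hj⟩
  have hUsub : ∀ j, ∀ ω' : Set (Sph m), (∀ x ∈ ω, ∃ y ∈ ω', dist x y < e j) →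
      U j ⊆ innerNhd (e j) ω' := by
    intro j ω' hω' n hn
    simp only [U, mem_iUnion, mem_ofPred_eq, exists_prop] at hn
    obtain ⟨x, hx, hn⟩ := hn
    obtain ⟨y, hy, hxy⟩ := hω' x hx
    have := (abs_le.1 (abs_inner_sub_inner_le n x y)).2
    exact ⟨y, hy, by linarith⟩
  by_cases hcase : ∀ n : Sph m, ∃ x ∈ ω, 0 < inner ℝ (n : EuclideanSpace ℝ (Fin (m + 1)))
      (x : EuclideanSpace ℝ (Fin (m + 1)))
  · obtain ⟨j, hj⟩ := isCompact_univ.elim_directed_cover U hUopen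
      (fun n _ => hUunion (hcase n)) hUmono.directed_le
    exact ⟨e j, he j, fun ω' h1 _ => Or.inl (univ_subset_iff.1 (hj.trans (hUsub j ω' h1)))⟩
  · push Not at hcase
    obtain ⟨n₀, hn₀⟩ := hcase
    have hlt := (hμ.measure_lt hne hn₀).trans_le (measure_mono hUunion)
    -- `μ ω < a < b < σ (⋃ j, U j)`: thickenings of `ω` have `μ`-measure below `a`, and `σ (U j)`
    -- exceeds `b`, so `b - a` is available as margin.
    obtain ⟨b, hb1, hb2⟩ := exists_between hlt
    obtain ⟨a, ha1, ha2⟩ := exists_between hb1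
    have ev1 : ∀ᶠ j in atTop, b < uniformMeasure m (U j) :=
      (tendsto_measure_iUnion_atTop hUmono).eventually_const_lt hb2
    have ev2 : ∀ᶠ j in atTop, μ (Metric.cthickening (e j) ω) < a :=
      ((tendsto_measure_cthickening_of_isClosed ⟨1, one_pos, measure_ne_top _ _⟩ hc).comp
        he0).eventually_lt_const ha1
    have ev3 : ∀ᶠ j in atTop, ENNReal.ofReal (e j) < b - a := by
      have h3 : Tendsto (fun j => ENNReal.ofReal (e j)) atTop (𝓝 0) := by
        simpa using ENNReal.tendsto_ofReal he0
      exact h3.eventually_lt_const (tsub_pos_of_lt ha2)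
    obtain ⟨j, hj1, hj2, hj3⟩ := (ev1.and (ev2.and ev3)).exists
    refine ⟨e j, he j, fun ω' h1 h2 => Or.inr ?_⟩
    have hsub : ω' ⊆ Metric.cthickening (e j) ω := by
      intro y hy
      obtain ⟨x, hx, hyx⟩ := h2 y hy
      exact Metric.mem_cthickening_of_dist_le y x _ _ hx hyx.le
    calc μ ω' + ENNReal.ofReal (e j) ≤ a + (b - a) :=
          add_le_add ((measure_mono hsub).trans hj2.le) hj3.le
      _ = b := add_tsub_cancel_of_le ha2.le
      _ ≤ uniformMeasure m (U j) := hj1.le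
      _ ≤ _ := measure_mono (hUsub j ω' h1)

/-- By compactness of the Hausdorff space of closed sets, the margin in Alexandrov's condition can
be chosen independently of the set. -/
theorem AlexandrovCondition.exists_uniformlySpread {μ : Measure (Sph m)}
    [IsFiniteMeasure μ] (hμ : AlexandrovCondition μ) :
    ∃ ε > 0, ε ≤ 1 ∧ ∀ ω : Set (Sph m), IsClosed ω → ω.Nonempty →
      UniformlySpread (uniformMeasure m) μ ε ω := by
  have key : ∃ ε > 0, ∀ ω ∈ (univ : Set (NonemptyCompacts (Sph m))),
      UniformlySpread (uniformMeasure m) μ ε ω := by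
    refine isCompact_univ.induction_on (p := fun S : Set (NonemptyCompacts (Sph m)) =>
      ∃ ε > 0, ∀ ω ∈ S, UniformlySpread (uniformMeasure m) μ ε (ω : Set (Sph m)))
      ⟨1, one_pos, by simp⟩ ?_ ?_ ?_
    · rintro S T hST ⟨ε, hε, h⟩
      exact ⟨ε, hε, fun ω hω => h ω (hST hω)⟩
    · rintro S T ⟨ε, hε, h⟩ ⟨ε', hε', h'⟩
      refine ⟨min ε ε', lt_min hε hε', ?_⟩
      rintro ω (hω | hω)
      · exact (h ω hω).anti (min_le_left _ _)
      · exact (h' ω hω).anti (min_le_right _ _)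
    · intro ω _
      obtain ⟨ε, hε, h⟩ := hμ.exists_uniformlySpread_near ω.isCompact.isClosed ω.nonempty
      refine ⟨Metric.ball ω ε, mem_nhdsWithin_of_mem_nhds (Metric.ball_mem_nhds ω hε), ε, hε,
        fun ω' hω' => ?_⟩
      have hfin : ∀ A B : NonemptyCompacts (Sph m),
          Metric.hausdorffEDist (A : Set (Sph m)) B ≠ ⊤ := fun A B =>
        Metric.hausdorffEDist_ne_top_of_nonempty_of_bounded A.nonempty B.nonempty
          A.isCompact.isBounded B.isCompact.isBounded
      refine h ω' (fun x hx => ?_) (fun y hy => ?_)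
      · exact Metric.exists_dist_lt_of_hausdorffDist_lt hx
          (by rw [← Metric.NonemptyCompacts.dist_eq]; exact Metric.mem_ball'.1 hω') (hfin _ _)
      · exact Metric.exists_dist_lt_of_hausdorffDist_lt hy
          (by rw [← Metric.NonemptyCompacts.dist_eq]; exact Metric.mem_ball.1 hω') (hfin _ _)
  obtain ⟨ε, hε, h⟩ := key
  refine ⟨min ε 1, lt_min hε one_pos, min_le_right _ _, fun ω hc hne => ?_⟩
  exact (h ⟨⟨ω, hc.isCompact⟩, hne⟩ (mem_univ _)).anti (min_le_left _ _)

end Alexandrov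

/-! ### The truncated cost -/

section TruncatedCost

variable {m : ℕ}

/-- The cost `c` truncated at the level `M`: `min c M = -log (max ⟪n, x⟫ e⁻ᴹ)`, a Lipschitz
function. -/
def truncatedCost (m : ℕ) (M : ℝ) : C(Sph m × Sph m, ℝ) where
  toFun p := -Real.log (max (inner ℝ (p.1 : EuclideanSpace ℝ (Fin (m + 1)))
    (p.2 : EuclideanSpace ℝ (Fin (m + 1)))) (Real.exp (-M)))
  continuous_toFun := by
    refine (Continuous.log (by fun_prop) fun p => ?_).neg
    exact ((Real.exp_pos _).trans_le (le_max_right _ _)).ne'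

theorem truncatedCost_apply (M : ℝ) (n x : Sph m) : truncatedCost m M (n, x) =
    -Real.log (max (inner ℝ (n : EuclideanSpace ℝ (Fin (m + 1)))
      (x : EuclideanSpace ℝ (Fin (m + 1)))) (Real.exp (-M))) := rfl

theorem truncatedCost_nonneg {M : ℝ} (hM : 0 ≤ M) : 0 ≤ truncatedCost m M := by
  intro p
  have h1 : Real.exp (-M) ≤ 1 := Real.exp_le_one_iff.2 (by linarith)
  have := Real.log_nonpos ((Real.exp_pos (-M)).le.trans (le_max_right _ _))
    (max_le (inner_le_one p.1 p.2) h1)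
  exact neg_nonneg.2 this

theorem truncatedCost_comm (M : ℝ) (n x : Sph m) :
    truncatedCost m M (n, x) = truncatedCost m M (x, n) := by
  rw [truncatedCost_apply, truncatedCost_apply, real_inner_comm]

theorem truncatedCost_le_neg_log {M : ℝ} {n x : Sph m} {ε : ℝ} (hε : 0 < ε)
    (h : ε ≤ inner ℝ (n : EuclideanSpace ℝ (Fin (m + 1)))
      (x : EuclideanSpace ℝ (Fin (m + 1)))) : truncatedCost m M (n, x) ≤ -Real.log ε := by
  rw [truncatedCost_apply]
  exact neg_le_neg (Real.log_le_log hε (h.trans (le_max_left _ _)))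

theorem lipschitzWith_truncatedCost (M : ℝ) (n : Sph m) :
    LipschitzWith (Real.toNNReal (Real.exp M)) (fun x => truncatedCost m M (n, x)) := by
  refine LipschitzWith.of_le_add_mul _ fun x y => ?_
  rw [Real.coe_toNNReal _ (Real.exp_pos M).le, truncatedCost_apply, truncatedCost_apply]
  set a := max (inner ℝ (n : EuclideanSpace ℝ (Fin (m + 1)))
    (x : EuclideanSpace ℝ (Fin (m + 1)))) (Real.exp (-M)) with ha
  set b := max (inner ℝ (n : EuclideanSpace ℝ (Fin (m + 1)))
    (y : EuclideanSpace ℝ (Fin (m + 1)))) (Real.exp (-M)) with hb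
  have hapos : 0 < a := (Real.exp_pos _).trans_le (le_max_right _ _)
  have hbpos : 0 < b := (Real.exp_pos _).trans_le (le_max_right _ _)
  have hainv : a⁻¹ ≤ Real.exp M := by
    rw [inv_le_comm₀ hapos (Real.exp_pos M), ← Real.exp_neg]
    exact le_max_right _ _
  have hba : b - a ≤ dist x y := by
    have h1 := abs_max_sub_max_le_abs (inner ℝ (n : EuclideanSpace ℝ (Fin (m + 1)))
      (y : EuclideanSpace ℝ (Fin (m + 1)))) (inner ℝ (n : EuclideanSpace ℝ (Fin (m + 1)))
      (x : EuclideanSpace ℝ (Fin (m + 1)))) (Real.exp (-M))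
    have h2 := abs_inner_sub_inner_le n y x
    rw [dist_comm] at h2
    exact (le_abs_self _).trans (h1.trans h2)
  -- `log b - log a ≤ b / a - 1 = (b - a) / a`
  have hlog := Real.log_le_sub_one_of_pos (div_pos hbpos hapos)
  rw [Real.log_div hbpos.ne' hapos.ne'] at hlog
  have hdiv : b / a - 1 = a⁻¹ * (b - a) := by field_simp
  have h3 : a⁻¹ * (b - a) ≤ Real.exp M * dist x y :=
    (mul_le_mul_of_nonneg_left hba (inv_pos.2 hapos).le).trans
      (mul_le_mul_of_nonneg_right hainv dist_nonneg)
  linarith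

theorem cost_of_inner_pos {n x : Sph m} (h : 0 < inner ℝ (n : EuclideanSpace ℝ (Fin (m + 1)))
    (x : EuclideanSpace ℝ (Fin (m + 1)))) :
    cost n x = ENNReal.ofReal (-Real.log (inner ℝ (n : EuclideanSpace ℝ (Fin (m + 1)))
      (x : EuclideanSpace ℝ (Fin (m + 1))))) := by
  rw [cost, if_pos (sphereDist_lt_pi_div_two_iff.2 h), cos_sphereDist]

theorem ofReal_truncatedCost_le (M : ℝ) (n x : Sph m) :
    ENNReal.ofReal (truncatedCost m M (n, x)) ≤ cost n x := by
  by_cases h : 0 < inner ℝ (n : EuclideanSpace ℝ (Fin (m + 1)))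
      (x : EuclideanSpace ℝ (Fin (m + 1)))
  · rw [cost_of_inner_pos h]
    exact ENNReal.ofReal_le_ofReal (truncatedCost_le_neg_log h le_rfl)
  · rw [cost, if_neg (mt sphereDist_lt_pi_div_two_iff.1 h)]
    exact le_top

theorem cost_eq_of_truncatedCost_lt {M : ℝ} {n x : Sph m} (h : truncatedCost m M (n, x) < M) :
    cost n x = ENNReal.ofReal (truncatedCost m M (n, x)) := by
  rw [truncatedCost_apply] at h ⊢
  have hlt : Real.exp (-M) < inner ℝ (n : EuclideanSpace ℝ (Fin (m + 1)))
      (x : EuclideanSpace ℝ (Fin (m + 1))) := by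
    by_contra! hcon
    rw [max_eq_right hcon, Real.log_exp] at h
    linarith
  rw [max_eq_left hlt.le, cost_of_inner_pos ((Real.exp_pos _).trans hlt)]

/-- Potentials conjugate for the truncated cost are conjugate for `c` as soon as their sum stays
below the level of truncation. -/
theorem cTransform_eq_of_contact {M : ℝ} (hM : 0 ≤ M) {f g : Sph m → ℝ}
    (hle : ∀ n x, f n + g x ≤ truncatedCost m M (n, x))
    (hcontact : ∀ x, ∃ n, f n + g x = truncatedCost m M (n, x)) (hlt : ∀ n x, f n + g x < M) :
    cTransform (fun n => (f n : EReal)) = fun x => (g x : EReal) := by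
  funext x
  refine le_antisymm ?_ (le_iInf fun n => ?_)
  · obtain ⟨n, hn⟩ := hcontact x
    refine iInf_le_of_le n ?_
    have hg : g x = truncatedCost m M (n, x) - f n := by linarith
    have h0 : 0 ≤ truncatedCost m M (n, x) := truncatedCost_nonneg hM _
    rw [cost_eq_of_truncatedCost_lt (hn ▸ hlt n x), EReal.coe_ennreal_ofReal,
      max_eq_left h0, hg, EReal.coe_sub]
  · rw [EReal.le_sub_iff_add_le (Or.inl (EReal.coe_ne_bot _)) (Or.inl (EReal.coe_ne_top _)),
      ← EReal.coe_add]
    calc ((g x + f n : ℝ) : EReal) ≤ (max (truncatedCost m M (n, x)) 0 : ℝ) :=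
          EReal.coe_le_coe_iff.2 (le_max_of_le_left (by linarith [hle n x]))
      _ = ((ENNReal.ofReal (truncatedCost m M (n, x)) : ℝ≥0∞) : EReal) :=
          (EReal.coe_ennreal_ofReal).symm
      _ ≤ _ := EReal.coe_ennreal_le_coe_ennreal_iff.2 (ofReal_truncatedCost_le M n x)

end TruncatedCost

/-! ### The a priori bound -/

section Bound

variable {m : ℕ}

instance : IsProbabilityMeasure (uniformMeasure m) := by
  refine ⟨?_⟩
  rw [uniformMeasure, Measure.smul_apply, smul_eq_mul]
  refine ENNReal.inv_mul_cancel ?_ (measure_ne_top _ _)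
  rw [Ne, Measure.measure_univ_eq_zero]
  exact Measure.toSphere_ne_zero _

theorem dist_le_sphereDist (x y : Sph m) : dist x y ≤ sphereDist x y := by
  refine abs_le_of_sq_le_sq' ?_ (InnerProductGeometry.angle_nonneg _ _) |>.2
  rw [Subtype.dist_eq, dist_eq_norm, norm_sub_sq_real, norm_eq_of_mem_sphere,
    norm_eq_of_mem_sphere, ← cos_sphereDist]
  have := Real.one_sub_sq_div_two_le_cos (x := sphereDist x y)
  change _ ≤ sphereDist x y ^ 2
  linarith

/-- If the sublevel sets of `-ψ` are spread with the margin `ε`, then a conjugate pair with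
`∫ φ dσ + ∫ ψ dμ ≥ 0` is bounded independently of the level of truncation. Indeed the sublevel set
`{-ψ ≤ s}` has its `ε`-neighbourhood contained in `{φ ≤ s + log (1/ε)}`; by the layer-cake formula,
`∫ -ψ dμ` exceeds `∫ (φ - log (1/ε))₊ dσ` by `ε (max φ - log (1/ε))` at least. -/
theorem IsConjugatePair.fst_le_of_uniformlySpread {σ μ : Measure (Sph m)}
    [IsProbabilityMeasure σ] [IsProbabilityMeasure μ] {ε : ℝ} (hε : 0 < ε) (hε1 : ε ≤ 1)
    (hspread : ∀ ω : Set (Sph m), IsClosed ω → ω.Nonempty → UniformlySpread σ μ ε ω)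
    {M : ℝ} {φ ψ : C(Sph m, ℝ)} (hc : IsConjugatePair (truncatedCost m M) φ ψ)
    (hJ : 0 ≤ ∫ n, φ n ∂σ + ∫ x, ψ x ∂μ) (n₀ : Sph m) :
    φ n₀ ≤ -Real.log ε + -Real.log ε / ε := by
  set l := -Real.log ε with hl
  have hl0 : 0 ≤ l := neg_nonneg.2 (Real.log_nonpos hε.le hε1)
  have hlε : 0 ≤ l / ε := div_nonneg hl0 hε.le
  obtain ⟨n₁, -, hn₁⟩ := isCompact_univ.exists_isMaxOn ⟨n₀, mem_univ n₀⟩ φ.continuous.continuousOn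
  have hmax : ∀ n, φ n ≤ φ n₁ := fun n => hn₁ (mem_univ n)
  refine (hmax n₀).trans ?_
  set R := φ n₁ with hR
  by_contra! hcon
  have hRl : l < R := by linarith
  let f : C(Sph m, ℝ) := ⟨fun n => max (φ n - l) 0, by fun_prop⟩
  have hf : ∀ n, f n = max (φ n - l) 0 := fun n => rfl
  have hf0 : ∀ n, 0 ≤ f n := fun n => le_max_right _ _
  have hψ0 : ∀ x, 0 ≤ (-ψ) x := fun x => neg_nonneg.2 (hc.nonpos x)
  -- The gain `ε` at each level `s < R - l` is the margin in Alexandrov's condition; at these levels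
  -- the alternative `innerNhd = univ` would force `φ ≤ s + l < R` everywhere.
  have key : ∀ s ∈ Ioi (0 : ℝ), σ {n | s < f n} +
      (Ioo 0 (R - l)).indicator (fun _ => ENNReal.ofReal ε) s ≤ μ {x | s < (-ψ) x} := by
    intro s hs
    have hs : 0 < s := hs
    by_cases hsR : s < R - l
    · rw [indicator_of_mem (show s ∈ Ioo 0 (R - l) from ⟨hs, hsR⟩)]
      have hclosed : IsClosed {x | (-ψ) x ≤ s} := isClosed_le (-ψ).continuous continuous_const
      have hsub : innerNhd ε {x | (-ψ) x ≤ s} ⊆ {n | f n ≤ s} := by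
        rintro n ⟨x, hx, hn⟩
        have h1 := hc.add_le (n, x)
        have h2 := truncatedCost_le_neg_log (M := M) hε hn
        have h3 : -ψ x ≤ s := hx
        exact max_le (by simp only at h1; linarith) hs.le
      have hle : μ {x | (-ψ) x ≤ s} + ENNReal.ofReal ε ≤ σ {n | f n ≤ s} := by
        rcases hspread _ hclosed (by
          obtain ⟨x, hx⟩ := hc.exists_zero
          exact ⟨x, by simp [hx, hs.le]⟩) with h | h
        · have h1 : n₁ ∈ {n | f n ≤ s} := hsub (h ▸ mem_univ n₁)
          have h2 : max (R - l) 0 ≤ s := h1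
          linarith [le_max_left (R - l) 0]
        · exact h.trans (measure_mono hsub)
      have hcompl₁ : {n | s < f n} = {n | f n ≤ s}ᶜ := by ext; simp
      have hcompl₂ : {x | s < (-ψ) x} = {x | (-ψ) x ≤ s}ᶜ := by ext; simp
      rw [hcompl₁, hcompl₂, prob_compl_eq_one_sub hclosed.measurableSet, prob_compl_eq_one_sub
        (isClosed_le f.continuous continuous_const).measurableSet]
      refine ENNReal.le_sub_of_add_le_right (measure_ne_top _ _) ?_
      rw [add_assoc, add_comm (ENNReal.ofReal ε)]
      exact (add_le_add le_rfl hle).trans_eq (tsub_add_cancel_of_le prob_le_one)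
    · rw [indicator_of_notMem (fun h => hsR h.2), add_zero]
      have hempty : {n | s < f n} = ∅ := by
        ext n
        simp only [mem_ofPred_eq, mem_empty_iff_false, iff_false, not_lt, hf]
        exact max_le (by linarith [hmax n]) hs.le
      rw [hempty, measure_empty]
      exact zero_le
  have hint := setLIntegral_mono' measurableSet_Ioi key (μ := volume)
  rw [lintegral_add_right _ (measurable_const.indicator measurableSet_Ioo),
    ← lintegral_eq_lintegral_meas_lt σ (Filter.Eventually.of_forall hf0)
      f.continuous.measurable.aemeasurable,
    ← lintegral_eq_lintegral_meas_lt μ (Filter.Eventually.of_forall hψ0)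
      (-ψ).continuous.measurable.aemeasurable,
    ← ofReal_integral_eq_lintegral_ofReal (integrable_continuousMap σ f)
      (Filter.Eventually.of_forall hf0),
    ← ofReal_integral_eq_lintegral_ofReal (integrable_continuousMap μ (-ψ))
      (Filter.Eventually.of_forall hψ0),
    lintegral_indicator measurableSet_Ioo, setLIntegral_const,
    Measure.restrict_apply measurableSet_Ioo, inter_eq_left.2 Ioo_subset_Ioi_self,
    Real.volume_Ioo, ← ENNReal.ofReal_mul hε.le,
    ← ENNReal.ofReal_add (integral_nonneg hf0) (mul_nonneg hε.le (by linarith)),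
    ENNReal.ofReal_le_ofReal_iff (integral_nonneg hψ0)] at hint
  have hfφ : ∫ n, φ n ∂σ - l ≤ ∫ n, f n ∂σ := by
    have h1 : ∫ n, (φ n - l) ∂σ = ∫ n, φ n ∂σ - l := by
      rw [integral_sub (integrable_continuousMap σ φ) (integrable_const _)]
      simp
    rw [← h1]
    exact integral_mono ((integrable_continuousMap σ φ).sub (integrable_const _))
      (integrable_continuousMap σ f) fun n => le_max_left _ _
  have hneg : ∫ x, (-ψ) x ∂μ = -∫ x, ψ x ∂μ := integral_neg _
  rw [hneg] at hint
  have h1 : ε * (l / ε) = l := by field_simp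
  have h2 : ε * (l / ε) < ε * (R - l) := mul_lt_mul_of_pos_left (by linarith) hε
  linarith

end Bound

/-! ### Optimal plans and the contact set -/

section OptimalPlans

variable {m : ℕ}

/-- A plan of finite cost concentrated on the contact set of `φ` and `ψ` forces every optimal plan
to be concentrated there, since `∫ φ dσ + ∫ ψ dμ` is a lower bound for the cost of all plans. -/
theorem support_subset_contact {σ μ : Measure (Sph m)} [IsProbabilityMeasure σ]
    [IsProbabilityMeasure μ] {M : ℝ} (hM : 0 ≤ M) {φ ψ : C(Sph m, ℝ)}
    (hle : ∀ p : Sph m × Sph m, φ p.1 + ψ p.2 ≤ truncatedCost m M p)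
    (hlt : ∀ p : Sph m × Sph m, φ p.1 + ψ p.2 < M)
    {P : Measure (Sph m × Sph m)} (hP : P ∈ transportPlans σ μ)
    (hPc : ∀ᵐ p ∂P, φ p.1 + ψ p.2 = truncatedCost m M p)
    {Q : Measure (Sph m × Sph m)} (hQ : Q ∈ optimalPlans σ μ) :
    Q.support ⊆ {p | φ p.1 + ψ p.2 = truncatedCost m M p} := by
  have hint : ∀ T ∈ transportPlans σ μ,
      ∫ p, directSum φ ψ p ∂T = ∫ n, φ n ∂σ + ∫ x, ψ x ∂μ := by
    rintro T ⟨hT, rfl, rfl⟩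
    rw [Measure.fst, Measure.snd, integral_map measurable_fst.aemeasurable
      φ.continuous.aestronglyMeasurable, integral_map measurable_snd.aemeasurable
      ψ.continuous.aestronglyMeasurable]
    exact integral_add
      (integrable_continuousMap T (φ.comp ContinuousMap.fst))
      (integrable_continuousMap T (ψ.comp ContinuousMap.snd))
  have hk := truncatedCost_nonneg (m := m) hM
  have hclosed : IsClosed {p : Sph m × Sph m | φ p.1 + ψ p.2 = truncatedCost m M p} :=
    isClosed_eq (by fun_prop) (truncatedCost m M).continuous
  refine Measure.support_subset_of_isClosed hclosed ?_
  have := hP.1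
  have := hQ.1.1
  have hPcost : transportCost P = ENNReal.ofReal (∫ p, truncatedCost m M p ∂P) := by
    rw [ofReal_integral_eq_lintegral_ofReal (integrable_continuousMap P _)
      (Filter.Eventually.of_forall hk)]
    refine lintegral_congr_ae ?_
    filter_upwards [hPc] with p hp
    exact cost_eq_of_truncatedCost_lt (hp ▸ hlt p)
  have hQcost : ENNReal.ofReal (∫ p, truncatedCost m M p ∂Q) ≤ transportCost Q := by
    rw [ofReal_integral_eq_lintegral_ofReal (integrable_continuousMap Q _)
      (Filter.Eventually.of_forall hk)]
    exact lintegral_mono fun p => ofReal_truncatedCost_le M p.1 p.2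
  have hPQ : ∫ p, truncatedCost m M p ∂Q ≤ ∫ p, truncatedCost m M p ∂P :=
    (ENNReal.ofReal_le_ofReal_iff (integral_nonneg hk)).1
      (hQcost.trans ((hQ.2 P hP).trans_eq hPcost))
  have hPeq : ∫ p, truncatedCost m M p ∂P = ∫ p, directSum φ ψ p ∂P := by
    refine integral_congr_ae ?_
    filter_upwards [hPc] with p hp
    exact hp.symm
  rw [hPeq, hint P hP, ← hint Q hQ.1] at hPQ
  have h0 : 0 ≤ truncatedCost m M - directSum φ ψ := fun p => sub_nonneg.2 (hle p)
  have hz : ∫ p, (truncatedCost m M - directSum φ ψ) p ∂Q = 0 := by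
    refine le_antisymm ?_ (integral_nonneg h0)
    have := integral_sub (integrable_continuousMap Q (truncatedCost m M))
      (integrable_continuousMap Q (directSum φ ψ))
    exact this.trans_le (sub_nonpos.2 hPQ)
  have hae := (integral_eq_zero_iff_of_nonneg h0 (integrable_continuousMap Q _)).1 hz
  filter_upwards [hae] with p hp
  have hp' : truncatedCost m M p - (φ p.1 + ψ p.2) = 0 := hp
  exact (sub_eq_zero.1 hp').symm

end OptimalPlans

end GaussOT

end

open GaussOT

theorem theorem4p2 (m : ℕ) (μ : MeasureTheory.Measure (GaussOT.Sph m))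
    [MeasureTheory.IsProbabilityMeasure μ] (hμ : GaussOT.AlexandrovCondition μ) :
    ∃ φ : GaussOT.Sph m → ℝ,
      (∃ K : ℝ, ∀ n n' : GaussOT.Sph m, |φ n - φ n'| ≤ K * GaussOT.sphereDist n n') ∧
      GaussOT.CConcave (fun n => (φ n : EReal)) ∧
      GaussOT.optimalSupport μ ⊆ GaussOT.cSubdifferential (fun n => (φ n : EReal)) := by
  obtain ⟨ε, hε, hε1, hspread⟩ := hμ.exists_uniformlySpread
  set R := -Real.log ε + -Real.log ε / ε with hR
  have hlog : 0 ≤ -Real.log ε := neg_nonneg.2 (Real.log_nonpos hε.le hε1)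
  have hR0 : 0 ≤ R := add_nonneg hlog (div_nonneg hlog hε.le)
  -- the truncation lies above the a priori bound `R`, so that the potentials do not feel it
  have hM : 0 ≤ R + 1 := by linarith
  obtain ⟨φ, ψ, hφL, hc, hopt⟩ := exists_optimal_conjugatePair (σ := uniformMeasure m) (μ := μ)
    (truncatedCost_nonneg hM) (truncatedCost_comm (R + 1)) (lipschitzWith_truncatedCost (R + 1))
  have hJ := hopt 0 0 (fun p => by simpa using truncatedCost_nonneg hM p)
  simp only [ContinuousMap.coe_zero, Pi.zero_apply, integral_zero, add_zero] at hJ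
  have hφR := hc.fst_le_of_uniformlySpread hε hε1 hspread hJ
  have hlt : ∀ n x, φ n + ψ x < R + 1 := fun n x => by linarith [hφR n, hc.nonpos x]
  obtain ⟨P, hP, hPσ, hPμ, hPc⟩ := exists_plan_of_optimal (truncatedCost m (R + 1)) φ ψ
    hc.add_le hopt
  have hφψ : cTransform (fun n => (φ n : EReal)) = fun x => (ψ x : EReal) :=
    cTransform_eq_of_contact hM (fun n x => hc.add_le (n, x)) hc.exists_fst hlt
  have hψφ : cTransform (fun x => (ψ x : EReal)) = fun n => (φ n : EReal) := by
    refine cTransform_eq_of_contact hM (fun x n => ?_) (fun n => ?_) fun x n => ?_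
    · rw [add_comm, truncatedCost_comm]
      exact hc.add_le (n, x)
    · obtain ⟨x, hx⟩ := hc.exists_snd n
      exact ⟨x, by rw [add_comm, truncatedCost_comm, hx]⟩
    · rw [add_comm]
      exact hlt n x
  refine ⟨φ, ⟨Real.toNNReal (Real.exp (R + 1)), fun n n' => ?_⟩, ⟨fun n => EReal.coe_lt_top _,
    fun x => ?_, ?_⟩, ?_⟩
  · exact ((Real.dist_eq _ _).symm.trans_le (hφL.dist_le_mul n n')).trans
      (mul_le_mul_of_nonneg_left (dist_le_sphereDist n n') (NNReal.coe_nonneg _))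
  · rw [hφψ]
    exact EReal.coe_lt_top _
  · rw [hφψ, hψφ]
  · have hclosed : IsClosed {p : Sph m × Sph m | φ p.1 + ψ p.2 = truncatedCost m (R + 1) p} :=
      isClosed_eq (by fun_prop) (truncatedCost m (R + 1)).continuous
    have hsupp : ∀ Q ∈ optimalPlans (uniformMeasure m) μ,
        Q.support ⊆ {p | φ p.1 + ψ p.2 = truncatedCost m (R + 1) p} := fun Q hQ =>
      support_subset_contact hM hc.add_le (fun p => hlt p.1 p.2) ⟨hP, hPσ, hPμ⟩ hPc hQ
    intro p hp
    have hp1 : φ p.1 + ψ p.2 = truncatedCost m (R + 1) p :=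
      closure_minimal (iUnion₂_subset hsupp) hclosed hp.1
    have hcost : cost p.1 p.2 = ENNReal.ofReal (truncatedCost m (R + 1) p) :=
      cost_eq_of_truncatedCost_lt (hp1.symm.trans_lt (hlt p.1 p.2))
    have h0 : 0 ≤ truncatedCost m (R + 1) p := truncatedCost_nonneg hM p
    rw [cSubdifferential, mem_ofPred_eq, hφψ, hcost, EReal.coe_ennreal_ofReal, max_eq_left h0,
      ← hp1, EReal.coe_add]
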